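/- Let $d \ge 2$ be an integer and $R > 0$ a real number. A body is a nonempty closed subset of the Euclidean space $\mathbb{E}^d$. A body $A$ is called an $R$-body if every point $y \in \mathbb{E}^d \setminus A$ lies in some open ball $B$ of radius $R$ with $B \subset \mathbb{E}^d \setminus A$. The Golubyatnikov–Rovenski class $\mathcal{K}_2^{1/R}$ consists of the bodies $A$ in $\mathbb{E}^d$ such that every point $x \in \mathbb{E}^d \setminus A$ lies in some closed ball $D$ of radius $R$ with $D \cap \operatorname{int}(A) = \emptyset$. Then the class of $R$-bodies in $\mathbb{E}^d$ is strictly contained in $\mathcal{K}_2^{1/R}$. Moreover: (i) if $d = 2$, then every $A \in \mathcal{K}_2^{1/R}$ with $A = \overline{\operatorname{int}(A)}$ is an $R$-body; (ii) if $d > 2$, then there exists $A \in \mathcal{K}_2^{1/R}$ with $A = \overline{\operatorname{int}(A)}$ that is not an $R$-body. -/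

import Mathlib

/-- A body: a nonempty closed subset of the Euclidean space of dimension `d`. -/
def IsBody {d : ℕ} (A : Set (EuclideanSpace ℝ (Fin d))) : Prop :=
  A.Nonempty ∧ IsClosed A

/-- The class of `R`-bodies: bodies `A` such that every point of the complement of `A` lies in
an open ball of radius `R` that is contained in the complement of `A`. -/
def RBodies (d : ℕ) (R : ℝ) : Set (Set (EuclideanSpace ℝ (Fin d))) :=
  {A | IsBody A ∧ ∀ y ∈ Aᶜ, ∃ c, y ∈ Metric.ball c R ∧ Metric.ball c R ⊆ Aᶜ}

/-- The Golubyatnikov–Rovenski class `K₂^{1/R}`: bodies `A` such that every point of the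
complement of `A` lies in a closed ball of radius `R` that is disjoint from the interior
of `A`. -/
def ClassK2 (d : ℕ) (R : ℝ) : Set (Set (EuclideanSpace ℝ (Fin d))) :=
  {A | IsBody A ∧
    ∀ x ∈ Aᶜ, ∃ c, x ∈ Metric.closedBall c R ∧ Metric.closedBall c R ∩ interior A = ∅}

open Filter Topology

/-! The inclusion holds because an open ball missing `A` has its closure missing `interior A`. It is
strict because a sphere of radius `R / 2` has empty interior, while every open `R`-ball containing
its centre meets it.

In the plane, translate the given point to `0` and suppose that no open `R`-disc containing `0`
misses `A`. Let `K` be the set of centres of the `R`-discs missing `A` with `0` on the boundary. A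
limiting argument puts a point of `K` in every open half-plane bounded by a line through `0`
(`exists_center_inner_pos`), so `0` is in the convex hull of `K`. By Carathéodory, either three
points of `K` positively span the plane or two are antipodal. Then `johnson_disc` or `rhombus_disc`
gives an `R`-disc containing `0` and covered by the discs at hand together with `0`, so it misses
`A`: a contradiction.

For `d > 2`, remove from space the open `R`-balls centred at the vertices of a regular simplex
inscribed in the `R`-sphere about `0`, and also the point `0`. The spheres meet in points so close
to `0` that every open `R`-ball containing `0` captures one of them. -/

theorem plane_norm_sq (x : EuclideanSpace ℝ (Fin 2)) : ‖x‖ ^ 2 = x 0 ^ 2 + x 1 ^ 2 := by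
  rw [EuclideanSpace.real_norm_sq_eq, Fin.sum_univ_two]

theorem plane_le_norm_iff {R : ℝ} (hR : 0 ≤ R) (x : EuclideanSpace ℝ (Fin 2)) :
    R ≤ ‖x‖ ↔ R ^ 2 ≤ x 0 ^ 2 + x 1 ^ 2 := by
  rw [← plane_norm_sq, sq_le_sq₀ hR (norm_nonneg x)]

theorem plane_norm_lt_iff {R : ℝ} (hR : 0 ≤ R) (x : EuclideanSpace ℝ (Fin 2)) :
    ‖x‖ < R ↔ x 0 ^ 2 + x 1 ^ 2 < R ^ 2 := by
  rw [← not_le, plane_le_norm_iff hR, not_le]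

theorem plane_norm_eq_iff {R : ℝ} (hR : 0 ≤ R) (x : EuclideanSpace ℝ (Fin 2)) :
    ‖x‖ = R ↔ x 0 ^ 2 + x 1 ^ 2 = R ^ 2 := by
  rw [← plane_norm_sq, sq_eq_sq₀ (norm_nonneg x) hR]

theorem plane_inner (x y : EuclideanSpace ℝ (Fin 2)) :
    inner ℝ x y = x 0 * y 0 + x 1 * y 1 := by
  simp [PiLp.inner_apply, Fin.sum_univ_two, mul_comm]

theorem plane_ne_zero_iff (x : EuclideanSpace ℝ (Fin 2)) :
    x ≠ 0 ↔ 0 < x 0 ^ 2 + x 1 ^ 2 := by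
  rw [← plane_norm_sq, ← norm_pos_iff]
  constructor
  · intro h; positivity
  · intro h
    by_contra hc
    exact absurd h (by rw [le_antisymm (not_lt.1 hc) (norm_nonneg x)]; simp)

/-! ### Planar discs covered by discs through a common point. -/

/-- Johnson's circle theorem, in the form: if `0` is a positive combination of three points of a
circle of radius `R` about `0`, then the open disc of radius `R` about their sum is covered by
the three open discs of radius `R` about the points, together with `0`. -/
theorem johnson_disc {R : ℝ} (hR : 0 < R) {c₁ c₂ c₃ : EuclideanSpace ℝ (Fin 2)}
    (h₁ : ‖c₁‖ = R) (h₂ : ‖c₂‖ = R) (h₃ : ‖c₃‖ = R) {l₁ l₂ l₃ : ℝ}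
    (hl₁ : 0 < l₁) (hl₂ : 0 < l₂) (hl₃ : 0 < l₃)
    (hs : l₁ • c₁ + l₂ • c₂ + l₃ • c₃ = 0) (hdet : c₁ 0 * c₂ 1 - c₁ 1 * c₂ 0 ≠ 0) :
    ∃ q : EuclideanSpace ℝ (Fin 2), ‖q‖ < R ∧ ∀ a ≠ 0, R ≤ ‖a - c₁‖ → R ≤ ‖a - c₂‖ →
      R ≤ ‖a - c₃‖ → R ≤ ‖a - q‖ := by
  have A1 : l₁ * c₁ 0 + l₂ * c₂ 0 + l₃ * c₃ 0 = 0 := by simpa using congrArg (fun x => x 0) hs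
  have A2 : l₁ * c₁ 1 + l₂ * c₂ 1 + l₃ * c₃ 1 = 0 := by simpa using congrArg (fun x => x 1) hs
  rw [plane_norm_eq_iff hR.le] at h₁ h₂ h₃
  have hR2 : R ^ 2 ≠ 0 := by positivity
  have hS : 0 < l₁ + l₂ + l₃ := by positivity
  -- The sum is the orthocentre of the triangle, whose circumcentre is `0`.
  refine ⟨c₁ + c₂ + c₃, ?_, ?_⟩
  all_goals
    simp only [plane_le_norm_iff hR.le, plane_norm_lt_iff hR.le, plane_ne_zero_iff,
      PiLp.add_apply, PiLp.sub_apply]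
    generalize c₁ 0 = p₁ at *
    generalize c₁ 1 = q₁ at *
    generalize c₂ 0 = p₂ at *
    generalize c₂ 1 = q₂ at *
    generalize c₃ 0 = p₃ at *
    generalize c₃ 1 = q₃ at *
    -- With `zⱼ = pⱼ + i qⱼ`, conjugate `∑ lⱼ zⱼ = 0` and multiply by `z₁ z₂ z₃`: `X` and `Y` are
    -- the real and imaginary parts of `l₁ z₂ z₃ + l₂ z₁ z₃ + l₃ z₁ z₂ = 0`. They kill the
    -- trace-free part of the quadratic form in `Q`.
    have X : l₁ * (p₂ * p₃ - q₂ * q₃) + l₂ * (p₁ * p₃ - q₁ * q₃) + l₃ * (p₁ * p₂ - q₁ * q₂) = 0 := by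
      refine (mul_eq_zero.1 ?_).resolve_left hR2
      linear_combination (p₁ * p₂ * p₃ - p₁ * q₂ * q₃ - q₁ * p₂ * q₃ - q₁ * q₂ * p₃) * A1
        + (q₁ * p₂ * p₃ + p₁ * q₂ * p₃ + p₁ * p₂ * q₃ - q₁ * q₂ * q₃) * A2
        - l₁ * (p₂ * p₃ - q₂ * q₃) * h₁ - l₂ * (p₁ * p₃ - q₁ * q₃) * h₂
        - l₃ * (p₁ * p₂ - q₁ * q₂) * h₃
    have Y : l₁ * (p₂ * q₃ + q₂ * p₃) + l₂ * (p₁ * q₃ + q₁ * p₃) + l₃ * (p₁ * q₂ + q₁ * p₂) = 0 := by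
      refine (mul_eq_zero.1 ?_).resolve_left hR2
      linear_combination -(p₁ * p₂ * p₃ - p₁ * q₂ * q₃ - q₁ * p₂ * q₃ - q₁ * q₂ * p₃) * A2
        + (q₁ * p₂ * p₃ + p₁ * q₂ * p₃ + p₁ * p₂ * q₃ - q₁ * q₂ * q₃) * A1
        - l₁ * (p₂ * q₃ + q₂ * p₃) * h₁ - l₂ * (p₁ * q₃ + q₁ * p₃) * h₂
        - l₃ * (p₁ * q₂ + q₁ * p₂) * h₃
    have Z : (l₁ + l₂ + l₃) * ((p₁ + p₂ + p₃) ^ 2 + (q₁ + q₂ + q₃) ^ 2 - R ^ 2)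
        = 2 * (l₁ * (p₂ * p₃ + q₂ * q₃) + l₂ * (p₁ * p₃ + q₁ * q₃)
          + l₃ * (p₁ * p₂ + q₁ * q₂)) := by
      linear_combination (2 * (p₁ + p₂ + p₃)) * A1 + (2 * (q₁ + q₂ + q₃)) * A2
        + (l₂ + l₃ - l₁) * h₁ + (l₁ + l₃ - l₂) * h₂ + (l₁ + l₂ - l₃) * h₃
    have Q : ∀ x y : ℝ, 4 * (l₁ * (x * p₂ + y * q₂) * (x * p₃ + y * q₃)
          + l₂ * (x * p₁ + y * q₁) * (x * p₃ + y * q₃)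
          + l₃ * (x * p₁ + y * q₁) * (x * p₂ + y * q₂))
        = (x ^ 2 + y ^ 2) * ((l₁ + l₂ + l₃) *
          ((p₁ + p₂ + p₃) ^ 2 + (q₁ + q₂ + q₃) ^ 2 - R ^ 2)) := by
      intro x y
      rw [Z]
      linear_combination (2 * (x ^ 2 - y ^ 2)) * X + 4 * x * y * Y
  -- At a vector orthogonal to `c₁` only the `l₁` term of `Q` survives, and `A1`, `A2` make it
  -- negative.
  · have h := Q (-q₁) p₁
    have e : l₃ * (-q₁ * p₃ + p₁ * q₃) = - l₂ * (p₁ * q₂ - q₁ * p₂) := by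
      linear_combination (-q₁) * A1 + p₁ * A2
    have h4 : 0 < l₁ * l₂ * (p₁ * q₂ - q₁ * p₂) ^ 2 := by positivity
    have h5 : R ^ 2 * l₃ * ((l₁ + l₂ + l₃) *
          ((p₁ + p₂ + p₃) ^ 2 + (q₁ + q₂ + q₃) ^ 2 - R ^ 2))
          = - 4 * (l₁ * l₂ * (p₁ * q₂ - q₁ * p₂) ^ 2) := by
      linear_combination (-l₃) * h - l₃ * ((l₁ + l₂ + l₃) *
          ((p₁ + p₂ + p₃) ^ 2 + (q₁ + q₂ + q₃) ^ 2 - R ^ 2)) * h₁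
          + 4 * l₁ * (p₁ * q₂ - q₁ * p₂) * e
    by_contra hc
    have : 0 ≤ (p₁ + p₂ + p₃) ^ 2 + (q₁ + q₂ + q₃) ^ 2 - R ^ 2 := by linarith
    have : 0 ≤ R ^ 2 * l₃ * ((l₁ + l₂ + l₃) *
          ((p₁ + p₂ + p₃) ^ 2 + (q₁ + q₂ + q₃) ^ 2 - R ^ 2)) := by positivity
    linarith
  · intro a ha
    generalize a 0 = x at *
    generalize a 1 = y at *
    intro g₁ g₂ g₃
    have t₁ : 0 ≤ x ^ 2 + y ^ 2 - 2 * (x * p₁ + y * q₁) := by linarith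
    have t₂ : 0 ≤ x ^ 2 + y ^ 2 - 2 * (x * p₂ + y * q₂) := by linarith
    have t₃ : 0 ≤ x ^ 2 + y ^ 2 - 2 * (x * p₃ + y * q₃) := by linarith
    have key : (x ^ 2 + y ^ 2) * (l₁ + l₂ + l₃) *
        ((x - (p₁ + p₂ + p₃)) ^ 2 + (y - (q₁ + q₂ + q₃)) ^ 2 - R ^ 2)
        = l₁ * (x ^ 2 + y ^ 2 - 2 * (x * p₂ + y * q₂)) * (x ^ 2 + y ^ 2 - 2 * (x * p₃ + y * q₃))
        + l₂ * (x ^ 2 + y ^ 2 - 2 * (x * p₁ + y * q₁)) * (x ^ 2 + y ^ 2 - 2 * (x * p₃ + y * q₃))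
        + l₃ * (x ^ 2 + y ^ 2 - 2 * (x * p₁ + y * q₁)) *
          (x ^ 2 + y ^ 2 - 2 * (x * p₂ + y * q₂)) := by
      linear_combination - (Q x y) - 2 * (x ^ 2 + y ^ 2) * (x * A1 + y * A2)
    have : 0 ≤ (x ^ 2 + y ^ 2) * (l₁ + l₂ + l₃) *
        ((x - (p₁ + p₂ + p₃)) ^ 2 + (y - (q₁ + q₂ + q₃)) ^ 2 - R ^ 2) := by
      rw [key]; positivity
    have := nonneg_of_mul_nonneg_right this (by positivity)
    linarith

/-- With `e, f = (c₁ ± c₂) / 2`, the circles about `±c₁`, `±c₂` meet away from `0` at the rhombus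
vertices `±2e`, `±2f`. The centre `q` is the circumcentre of `2e`, `2f`, `-2f`; the circumradius
exceeds `R`, and `‖f‖ ≤ ‖e‖` keeps `-2e` at least as far away. -/
theorem rhombus_disc_aux {R : ℝ} (hR : 0 < R) {c₁ c₂ : EuclideanSpace ℝ (Fin 2)}
    (h₁ : ‖c₁‖ = R) (h₂ : ‖c₂‖ = R) (hne : c₁ ≠ c₂) (hi : 0 ≤ inner ℝ c₁ c₂) :
    ∃ q : EuclideanSpace ℝ (Fin 2), ‖q‖ < R ∧ ∀ a ≠ 0, R ≤ ‖a - c₁‖ → R ≤ ‖a + c₁‖ →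
      R ≤ ‖a - c₂‖ → R ≤ ‖a + c₂‖ → R ≤ ‖a - q‖ := by
  rw [plane_norm_eq_iff hR.le] at h₁ h₂
  rw [plane_inner] at hi
  rw [← sub_ne_zero, plane_ne_zero_iff] at hne
  simp only [PiLp.sub_apply] at hne
  set e0 := (c₁ 0 + c₂ 0) / 2 with he0
  set e1 := (c₁ 1 + c₂ 1) / 2 with he1
  set f0 := (c₁ 0 - c₂ 0) / 2 with hf0
  set f1 := (c₁ 1 - c₂ 1) / 2 with hf1
  have k10 : c₁ 0 = e0 + f0 := by rw [he0, hf0]; ring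
  have k11 : c₁ 1 = e1 + f1 := by rw [he1, hf1]; ring
  have k20 : c₂ 0 = e0 - f0 := by rw [he0, hf0]; ring
  have k21 : c₂ 1 = e1 - f1 := by rw [he1, hf1]; ring
  clear_value e0 e1 f0 f1
  rw [k10, k11] at h₁
  rw [k20, k21] at h₂
  rw [k10, k11, k20, k21] at hne hi
  have horth : e0 * f0 + e1 * f1 = 0 := by linarith
  obtain ⟨E, hE⟩ : ∃ E, E = e0 ^ 2 + e1 ^ 2 := ⟨_, rfl⟩
  obtain ⟨F, hF⟩ : ∃ F, F = f0 ^ 2 + f1 ^ 2 := ⟨_, rfl⟩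
  have hEF : E + F = R ^ 2 := by rw [hE, hF]; linarith
  have hFpos : 0 < F := by rw [hF]; linarith
  have hFE : F ≤ E := by rw [hE, hF]; linarith
  have hEpos : 0 < E := by linarith
  refine ⟨!₂[(1 - F / E) * e0, (1 - F / E) * e1], ?_, ?_⟩
  · rw [plane_norm_lt_iff hR.le]
    have : ((1 - F / E) * e0) ^ 2 + ((1 - F / E) * e1) ^ 2 = (1 - F / E) ^ 2 * E := by
      rw [hE]; ring
    simp only [Matrix.cons_val_zero, Matrix.cons_val_one]
    rw [this, ← hEF]
    have h0 : 0 ≤ F / E := by positivity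
    have h1 : F / E ≤ 1 := by rw [div_le_one hEpos]; exact hFE
    nlinarith [mul_le_mul_of_nonneg_right (pow_le_one₀ (n := 2) (by linarith : 0 ≤ 1 - F / E) (by linarith)) hEpos.le]
  · intro a ha
    simp only [plane_le_norm_iff hR.le, PiLp.add_apply, PiLp.sub_apply,
      Matrix.cons_val_zero, Matrix.cons_val_one, k10, k11, k20, k21]
    rw [plane_ne_zero_iff] at ha
    generalize a 0 = x at *
    generalize a 1 = y at *
    intro g₁ g₂ g₃ g₄
    obtain ⟨N, hN⟩ : ∃ N, N = x ^ 2 + y ^ 2 := ⟨_, rfl⟩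
    obtain ⟨s, hs⟩ : ∃ s, s = x * e0 + y * e1 := ⟨_, rfl⟩
    obtain ⟨t, ht⟩ : ∃ t, t = x * f0 + y * f1 := ⟨_, rfl⟩
    rw [← hN] at ha
    have b₁ : 2 * (s + t) ≤ N := by rw [hs, ht, hN]; linarith
    have b₂ : -2 * (s + t) ≤ N := by rw [hs, ht, hN]; linarith
    have b₃ : 2 * (s - t) ≤ N := by rw [hs, ht, hN]; linarith
    have b₄ : -2 * (s - t) ≤ N := by rw [hs, ht, hN]; linarith
    -- Parseval in the orthogonal basis `e`, `f`; it eliminates `E` from the goal and leaves an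
    -- inequality on `2|s| + 2|t| ≤ N`.
    have hpars : N * E * F = s ^ 2 * F + t ^ 2 * E := by
      rw [hN, hs, ht, hE, hF]
      linear_combination ((x ^ 2 + y ^ 2) * (e0 * f0 + e1 * f1)
        - 2 * (x * e0 + y * e1) * (x * f0 + y * f1)) * horth
    obtain ⟨φ, hφ⟩ : ∃ φ, φ = F / E := ⟨_, rfl⟩
    have hφ0 : 0 < φ := by rw [hφ]; positivity
    have hφ1 : φ ≤ 1 := by rw [hφ, div_le_one hEpos]; exact hFE
    have hFφ : F = φ * E := by rw [hφ]; field_simp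
    rw [← hφ]
    have hpars' : N * E * φ = s ^ 2 * φ + t ^ 2 := by
      rw [hFφ] at hpars
      exact mul_right_cancel₀ hEpos.ne' (by linear_combination hpars)
    have hgoal : (x - (1 - φ) * e0) ^ 2 + (y - (1 - φ) * e1) ^ 2 - R ^ 2
        = N - 2 * (1 - φ) * s - (3 * φ - φ ^ 2) * E := by
      rw [← hEF, hFφ, hN, hs]
      linear_combination (-(1 - φ) ^ 2) * hE
    suffices h : 0 ≤ N * (N - 2 * (1 - φ) * s - (3 * φ - φ ^ 2) * E) by
      have := nonneg_of_mul_nonneg_right h ha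
      linarith
    have habs : 2 * |s| + 2 * |t| ≤ N := by
      rcases abs_cases s with h | h <;> rcases abs_cases t with h' | h' <;> linarith
    have hsl : s ≤ |s| := le_abs_self s
    have hs2 : s ^ 2 = |s| ^ 2 := (sq_abs s).symm
    have ht2 : t ^ 2 ≤ (N / 2 - |s|) ^ 2 := by
      rw [← sq_abs t]
      exact pow_le_pow_left₀ (abs_nonneg t) (by linarith) 2
    have hu : 0 ≤ |s| := abs_nonneg s
    have hu2 : 2 * |s| ≤ N := by linarith [abs_nonneg t]
    have hexp : N * (N - 2 * (1 - φ) * s - (3 * φ - φ ^ 2) * E)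
        = N ^ 2 - 2 * (1 - φ) * s * N - (3 - φ) * (|s| ^ 2 * φ + t ^ 2) := by
      rw [← hs2]
      linear_combination (-(3 - φ)) * hpars'
    rw [hexp]
    generalize |s| = u at *
    have m1 : (1 - φ) * N * s ≤ (1 - φ) * N * u :=
      mul_le_mul_of_nonneg_left hsl (mul_nonneg (by linarith) ha.le)
    have m2 : (3 - φ) * t ^ 2 ≤ 4 * (N / 2 - u) ^ 2 :=
      mul_le_mul (by linarith) ht2 (sq_nonneg t) (by norm_num)
    have m3 : 0 ≤ u * (N - 2 * u) := mul_nonneg hu (by linarith)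
    have m4 : 0 ≤ (1 + φ) * (u * (N - 2 * u)) := mul_nonneg (by linarith) m3
    have m5 : 0 ≤ (φ + φ ^ 2) * u ^ 2 := by positivity
    linarith

theorem rhombus_disc {R : ℝ} (hR : 0 < R) {c₁ c₂ : EuclideanSpace ℝ (Fin 2)}
    (h₁ : ‖c₁‖ = R) (h₂ : ‖c₂‖ = R) (hne : c₁ ≠ c₂) (hne' : c₁ ≠ -c₂) :
    ∃ q : EuclideanSpace ℝ (Fin 2), ‖q‖ < R ∧ ∀ a ≠ 0, R ≤ ‖a - c₁‖ → R ≤ ‖a + c₁‖ →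
      R ≤ ‖a - c₂‖ → R ≤ ‖a + c₂‖ → R ≤ ‖a - q‖ := by
  rcases le_total 0 (inner ℝ c₁ c₂) with h | h
  · exact rhombus_disc_aux hR h₁ h₂ hne h
  · obtain ⟨q, hq, H⟩ := rhombus_disc_aux hR h₁ (c₂ := -c₂) (by simpa using h₂) hne'
      (by simpa using h)
    refine ⟨q, hq, fun a ha g₁ g₂ g₃ g₄ => H a ha g₁ g₂ ?_ ?_⟩
    · simpa using g₄
    · simpa [sub_eq_add_neg] using g₃

/-! ### Discs missing `A` with `0` on the boundary. -/

theorem plane_inner_mul_add {R : ℝ} (hR : 0 < R) {c v : EuclideanSpace ℝ (Fin 2)} (hc : ‖c‖ = R)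
    (hv : ‖v‖ = R) (hcv : inner ℝ c v = 0) (x y : EuclideanSpace ℝ (Fin 2)) :
    inner ℝ x v * inner ℝ y v + inner ℝ x c * inner ℝ y c = R ^ 2 * inner ℝ x y := by
  rw [plane_norm_eq_iff hR.le] at hc hv
  simp only [plane_inner] at *
  refine mul_left_cancel₀ (pow_ne_zero 2 hR.ne') ?_
  linear_combination (-((x 0 * v 0 + x 1 * v 1) * (y 0 * v 0 + y 1 * v 1))
    + (x 0 * y 0 + x 1 * y 1) * (v 0 ^ 2 + v 1 ^ 2)) * hc
    + (-((x 0 * c 0 + x 1 * c 1) * (y 0 * c 0 + y 1 * c 1))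
    + (x 0 * y 0 + x 1 * y 1) * R ^ 2) * hv
    + ((x 0 * c 0 + x 1 * c 1) * (y 0 * v 0 + y 1 * v 1)
    + (x 0 * v 0 + x 1 * v 1) * (y 0 * c 0 + y 1 * c 1)
    - (x 0 * y 0 + x 1 * y 1) * (c 0 * v 0 + c 1 * v 1)) * hcv

/-- If `0` lies in no open disc of radius `R` missing `A`, then each disc of radius `R` that
misses `A` and has `0` on its boundary is touched by `A` on both sides of its centre line. -/
theorem exists_touching_point {R : ℝ} (hR : 0 < R) {A : Set (EuclideanSpace ℝ (Fin 2))}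
    (hA : IsClosed A) (h0 : (0 : EuclideanSpace ℝ (Fin 2)) ∉ A)
    (hbad : ∀ q : EuclideanSpace ℝ (Fin 2), ‖q‖ < R → ∃ a ∈ A, ‖a - q‖ < R)
    {c v : EuclideanSpace ℝ (Fin 2)} (hc : ‖c‖ = R) (hcA : ∀ a ∈ A, R ≤ ‖a - c‖)
    (hv : ‖v‖ = R) (hcv : inner ℝ c v = 0) :
    ∃ a ∈ A, ‖a‖ ^ 2 = 2 * inner ℝ a c ∧ 0 < inner ℝ a v := by
  obtain ⟨r, hr, hrA⟩ : ∃ r > 0, ∀ a ∈ A, r ≤ ‖a‖ := by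
    obtain ⟨r, hr, h⟩ := Metric.isOpen_iff.1 hA.isOpen_compl 0 h0
    refine ⟨r, hr, fun a ha => ?_⟩
    by_contra hlt
    exact h (by simpa using hlt) ha
  -- The centre is pushed from `c` along `w`: inwards, so that `0` enters the disc, but mostly
  -- sideways. This slope suffices because touching points are at distance at least `r` from `0`.
  set l : ℝ := 2 * R / r with hl
  have hlpos : 0 < l := by positivity
  have hcc : inner ℝ c c = R ^ 2 := by rw [real_inner_self_eq_norm_sq, hc]
  have hvv : inner ℝ v v = R ^ 2 := by rw [real_inner_self_eq_norm_sq, hv]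
  set w := l • v - c with hw
  have hcw : inner ℝ c w = -R ^ 2 := by
    rw [hw, inner_sub_right, inner_smul_right, hcv, hcc]; ring
  have hww : ‖w‖ ^ 2 = R ^ 2 * (1 + l ^ 2) := by
    rw [hw, norm_sub_sq_real, norm_smul, inner_smul_left, real_inner_comm, hcv, hc, hv, mul_pow,
      Real.norm_eq_abs, sq_abs]
    simp; ring
  have hq : ∀ t : ℝ, ‖c + t • w‖ ^ 2 = R ^ 2 * (1 - 2 * t + t ^ 2 * (1 + l ^ 2)) := by
    intro t
    rw [norm_add_sq_real, inner_smul_right, hcw, norm_smul, mul_pow, hww, hc, Real.norm_eq_abs,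
      sq_abs]
    ring
  -- The step `t` satisfies `t * (1 + l ^ 2) ≤ 1`, which keeps the moved centre strictly within `R`
  -- of `0`.
  have hex : ∀ n : ℕ, ∃ a ∈ A, ‖a - (c + (1 / ((n : ℝ) + 1 + l ^ 2)) • w)‖ < R := by
    intro n
    apply hbad
    have hpos : 0 < (n : ℝ) + 1 + l ^ 2 := by positivity
    set t := 1 / ((n : ℝ) + 1 + l ^ 2) with ht
    have ht0 : 0 < t := by positivity
    have ht1 : t * (1 + l ^ 2) ≤ 1 := by
      rw [ht, one_div, inv_mul_le_iff₀ hpos]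
      have : (0 : ℝ) ≤ n := n.cast_nonneg
      linarith
    refine lt_of_pow_lt_pow_left₀ 2 hR.le ?_
    rw [hq]
    have h1 : t ^ 2 * (1 + l ^ 2) ≤ t := by nlinarith
    nlinarith [mul_lt_mul_of_pos_left (by linarith : 1 - 2 * t + t ^ 2 * (1 + l ^ 2) < 1)
      (by positivity : 0 < R ^ 2)]
  choose a haA ha using hex
  have hneg : ∀ n, 0 ≤ inner ℝ (a n - c) w := by
    intro n
    have hpos : 0 < (n : ℝ) + 1 + l ^ 2 := by positivity
    set t := 1 / ((n : ℝ) + 1 + l ^ 2) with ht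
    have ht0 : 0 < t := by positivity
    have h1 := ha n
    have h2 := hcA _ (haA n)
    have h3 : ‖(a n - c) - t • w‖ ^ 2 < ‖a n - c‖ ^ 2 := by
      have : (a n - c) - t • w = a n - (c + t • w) := by abel
      rw [this]
      exact pow_lt_pow_left₀ (h1.trans_le h2) (norm_nonneg _) two_ne_zero
    rw [norm_sub_sq_real, inner_smul_right] at h3
    have h4 : 0 ≤ ‖t • w‖ ^ 2 := by positivity
    by_contra hlt
    nlinarith
  have htend : Tendsto (fun n : ℕ => 1 / ((n : ℝ) + 1 + l ^ 2)) atTop (𝓝 0) := by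
    simp only [one_div, add_assoc]
    exact tendsto_inv_atTop_zero.comp
      (tendsto_atTop_add_const_right _ _ tendsto_natCast_atTop_atTop)
  have hball : ∀ n, a n ∈ Metric.closedBall (0 : EuclideanSpace ℝ (Fin 2)) (2 * R + ‖w‖) := by
    intro n
    set t := 1 / ((n : ℝ) + 1 + l ^ 2) with ht
    have ht0 : 0 ≤ t := by positivity
    have ht1 : t ≤ 1 := by
      rw [ht, div_le_one (by positivity)]
      have : (0 : ℝ) ≤ n := n.cast_nonneg
      nlinarith
    rw [mem_closedBall_zero_iff]
    have e : a n = (a n - (c + t • w)) + (c + t • w) := by abel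
    rw [e]
    refine (norm_add_le _ _).trans ?_
    have : ‖t • w‖ ≤ ‖w‖ := by
      rw [norm_smul, Real.norm_of_nonneg ht0]
      exact mul_le_of_le_one_left (norm_nonneg _) ht1
    linarith [norm_add_le c (t • w), ha n]
  obtain ⟨b, -, φ, hφ, hb⟩ := (isCompact_closedBall _ _).tendsto_subseq hball
  have hbA : b ∈ A := hA.mem_of_tendsto hb (Eventually.of_forall fun n => haA _)
  have hle : ‖b - c‖ ≤ R := by
    have h1 : Tendsto (fun n => ‖a (φ n) - (c + (1 / ((φ n : ℝ) + 1 + l ^ 2)) • w)‖) atTop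
        (𝓝 ‖b - (c + (0 : ℝ) • w)‖) :=
      (hb.sub (tendsto_const_nhds.add
        ((htend.comp hφ.tendsto_atTop).smul tendsto_const_nhds))).norm
    simpa using le_of_tendsto h1 (Eventually.of_forall fun n => (ha (φ n)).le)
  have hbc : ‖b - c‖ = R := le_antisymm hle (hcA b hbA)
  have hbn : ‖b‖ ^ 2 = 2 * inner ℝ b c := by
    have := norm_sub_sq_real b c
    rw [hbc, hc] at this
    linarith
  have hbw : 0 ≤ inner ℝ (b - c) w :=
    ge_of_tendsto ((hb.sub tendsto_const_nhds).inner tendsto_const_nhds)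
      (Eventually.of_forall fun n => hneg _)
  refine ⟨b, hbA, hbn, ?_⟩
  by_contra hlt
  have hbr : r ^ 2 ≤ ‖b‖ ^ 2 := pow_le_pow_left₀ hr.le (hrA b hbA) 2
  rw [inner_sub_left, hcw, hw, inner_sub_right, inner_smul_right] at hbw
  have hpars : inner ℝ b v ^ 2 + inner ℝ b c ^ 2 = R ^ 2 * ‖b‖ ^ 2 := by
    have := plane_inner_mul_add hR hc hv hcv b b
    rw [real_inner_self_eq_norm_sq] at this
    linarith
  generalize inner ℝ b v = s at *
  generalize inner ℝ b c = z at *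
  have hrl : l * r = 2 * R := by rw [hl]; field_simp
  have h1 : l * (-s) ≤ R ^ 2 := by nlinarith
  have h2 : (l * (-s)) ^ 2 ≤ (R ^ 2) ^ 2 :=
    pow_le_pow_left₀ (mul_nonneg hlpos.le (by linarith)) h1 2
  have h3 : 0 ≤ R ^ 2 - z := by
    have : 0 ≤ l * (-s) := mul_nonneg hlpos.le (by linarith)
    nlinarith
  have h4 : r ^ 2 * R ^ 2 ≤ 2 * s ^ 2 := by
    have : 2 * s ^ 2 = ‖b‖ ^ 2 * R ^ 2 + ‖b‖ ^ 2 * (R ^ 2 - z) := by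
      linear_combination 2 * hpars + z * hbn
    rw [this]
    have : 0 ≤ ‖b‖ ^ 2 * (R ^ 2 - z) := by positivity
    nlinarith [sq_nonneg R]
  have h5 : l ^ 2 * (r ^ 2 * R ^ 2) ≤ l ^ 2 * (2 * s ^ 2) :=
    mul_le_mul_of_nonneg_left h4 (sq_nonneg l)
  have h6 : l ^ 2 * (r ^ 2 * R ^ 2) = 4 * R ^ 4 := by
    rw [← mul_assoc, ← mul_pow, hrl]; ring
  have h7 : 0 < R ^ 4 := by positivity
  linarith

/-- If every point near `0` is within `R` of the centre of some disc of radius `R` missing `A`,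
and `0` lies in no such open disc, then the discs missing `A` with `0` on the boundary have
centres in every open half-plane. -/
theorem exists_center_inner_pos {R : ℝ} (hR : 0 < R) {A : Set (EuclideanSpace ℝ (Fin 2))}
    (hA : IsClosed A) (h0 : (0 : EuclideanSpace ℝ (Fin 2)) ∉ A)
    (hcov : ∀ x ∉ A, ∃ c, ‖x - c‖ ≤ R ∧ ∀ a ∈ A, R ≤ ‖a - c‖)
    (hbad : ∀ q : EuclideanSpace ℝ (Fin 2), ‖q‖ < R → ∃ a ∈ A, ‖a - q‖ < R)
    {v : EuclideanSpace ℝ (Fin 2)} (hv : ‖v‖ = R) :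
    ∃ c, ‖c‖ = R ∧ (∀ a ∈ A, R ≤ ‖a - c‖) ∧ 0 < inner ℝ c v := by
  obtain ⟨δ, hδ, hδA⟩ := Metric.isOpen_iff.1 hA.isOpen_compl 0 h0
  obtain ⟨u, hupos, hult, hu⟩ : ∃ u : ℕ → ℝ, (∀ n, 0 < u n) ∧ (∀ n, u n * R < δ) ∧
      Tendsto u atTop (𝓝 0) := by
    obtain ⟨u, -, hu, hlim⟩ := exists_seq_strictAnti_tendsto' (show (0 : ℝ) < δ / R by positivity)
    exact ⟨u, fun n => (hu n).1, fun n => (lt_div_iff₀ hR).1 (hu n).2, hlim⟩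
  have hex : ∀ n, ∃ c, ‖u n • v - c‖ ≤ R ∧ ∀ a ∈ A, R ≤ ‖a - c‖ := by
    intro n
    apply hcov
    apply hδA
    rw [mem_ball_zero_iff, norm_smul, hv, Real.norm_of_nonneg (hupos n).le]
    exact hult n
  choose k hk hkA using hex
  have hkR : ∀ n, R ≤ ‖k n‖ := by
    intro n
    by_contra hlt
    obtain ⟨a, ha, h⟩ := hbad (k n) (not_le.1 hlt)
    exact absurd (hkA n a ha) (not_le.2 h)
  have hlune : ∀ n, ‖k n‖ ^ 2 + u n ^ 2 * R ^ 2 ≤ R ^ 2 + 2 * u n * inner ℝ (k n) v := by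
    intro n
    have := pow_le_pow_left₀ (norm_nonneg _) (hk n) 2
    rw [norm_sub_sq_real, norm_smul, hv, inner_smul_left, Real.norm_of_nonneg (hupos n).le,
      real_inner_comm] at this
    simp only [conj_trivial] at this
    linarith
  have hkpos : ∀ n, 0 < inner ℝ (k n) v := by
    intro n
    have h1 := hlune n
    have h2 := pow_le_pow_left₀ hR.le (hkR n) 2
    have h3 : 0 < u n ^ 2 * R ^ 2 := mul_pos (pow_pos (hupos n) 2) (by positivity)
    by_contra hlt
    have : u n * inner ℝ (k n) v ≤ 0 := mul_nonpos_of_nonneg_of_nonpos (hupos n).le (not_lt.1 hlt)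
    linarith
  have hball : ∀ n, k n ∈ Metric.closedBall (0 : EuclideanSpace ℝ (Fin 2)) (R + δ) := by
    intro n
    rw [mem_closedBall_zero_iff]
    have e : k n = u n • v - (u n • v - k n) := by abel
    rw [e]
    refine (norm_sub_le _ _).trans ?_
    have : ‖u n • v‖ < δ := by
      rw [norm_smul, hv, Real.norm_of_nonneg (hupos n).le]; exact hult n
    linarith [hk n]
  obtain ⟨c, -, φ, hφ, hlim⟩ := (isCompact_closedBall _ _).tendsto_subseq hball
  have huφ : Tendsto (fun n => u (φ n)) atTop (𝓝 0) := hu.comp hφ.tendsto_atTop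
  have hcA : ∀ a ∈ A, R ≤ ‖a - c‖ := fun a ha =>
    ge_of_tendsto (tendsto_const_nhds.sub hlim).norm (Eventually.of_forall fun n => hkA _ a ha)
  have hcR : ‖c‖ = R := by
    refine le_antisymm ?_ (ge_of_tendsto hlim.norm (Eventually.of_forall fun n => hkR _))
    have h1 : Tendsto (fun n => ‖u (φ n) • v - k (φ n)‖) atTop (𝓝 ‖(0 : ℝ) • v - c‖) :=
      ((huφ.smul tendsto_const_nhds).sub hlim).norm
    simpa using le_of_tendsto h1 (Eventually.of_forall fun n => hk (φ n))
  have hcv : 0 ≤ inner ℝ c v := ge_of_tendsto (hlim.inner tendsto_const_nhds)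
    (Eventually.of_forall fun n => (hkpos _).le)
  refine ⟨c, hcR, hcA, lt_of_le_of_ne hcv fun hzero => ?_⟩
  obtain ⟨a, haA, hac, hav⟩ := exists_touching_point hR hA h0 hbad hcR hcA hv hzero.symm
  set M := |inner ℝ a c - R ^ 2| with hM
  have hM0 : 0 ≤ M := abs_nonneg _
  have hw : Tendsto (fun n => k (φ n) - c) atTop (𝓝 0) := by
    simpa using hlim.sub (tendsto_const_nhds (x := c))
  -- If `c ⊥ v`, the displacement `w = k - c` is tangential to first order: its component along `c`
  -- is second order. Keeping `a` out of the moved disc then bounds `⟪a, v⟫ ⟪w, v⟫` by second-order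
  -- terms; dividing by `⟪w, v⟫ > 0` forces `⟪a, v⟫ ≤ 0` in the limit.
  have hmain : ∀ᶠ n in atTop, 2 * inner ℝ a v * R ^ 2 ≤
      (R ^ 2 + M) * (2 * inner ℝ (k (φ n) - c) v + 2 * R * ‖k (φ n) - c‖ * u (φ n))
        + 2 * M * R ^ 2 * u (φ n) := by
    have hsmall : ∀ᶠ n in atTop, ‖k (φ n) - c‖ < R :=
      (tendsto_order.1 hw.norm).2 R (by simpa using hR)
    filter_upwards [hsmall] with n hn
    have hε := hupos (φ n)
    have hl := hlune (φ n)
    have hX := hkpos (φ n)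
    have hkn := hkR (φ n)
    have hkac := hkA (φ n) a haA
    obtain ⟨w, hwdef⟩ : ∃ w, w = k (φ n) - c := ⟨_, rfl⟩
    have hkw : k (φ n) = c + w := by rw [hwdef]; abel
    rw [← hwdef] at hn ⊢
    rw [hkw] at hl hX hkn hkac
    have hkn2 := pow_le_pow_left₀ hR.le hkn 2
    have hac2 := pow_le_pow_left₀ hR.le hkac 2
    rw [norm_add_sq_real, hcR] at hl hkn2
    rw [inner_add_left, ← hzero, zero_add] at hX hl
    rw [norm_sub_sq_real, norm_add_sq_real, inner_add_right, hcR, hac] at hac2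
    have hexp := plane_inner_mul_add hR hcR hv hzero.symm a w
    have hexp2 := plane_inner_mul_add hR hcR hv hzero.symm w w
    rw [real_inner_self_eq_norm_sq] at hexp2
    have hMY : -(M * |inner ℝ c w|) ≤ (inner ℝ a c - R ^ 2) * inner ℝ c w := by
      rw [hM, ← abs_mul]; exact neg_abs_le _
    have hYW : |inner ℝ c w| ≤ R * ‖w‖ := by
      rw [← hcR]; exact abs_real_inner_le_norm _ _
    rw [real_inner_comm c w] at hexp hexp2
    have hY0 : 0 ≤ |inner ℝ c w| := abs_nonneg _
    have hYsq : inner ℝ c w ^ 2 = |inner ℝ c w| ^ 2 := (sq_abs _).symm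
    have hεR : 0 < u (φ n) ^ 2 * R ^ 2 := by positivity
    have hYε : 2 * |inner ℝ c w| ≤ 2 * u (φ n) * inner ℝ w v + ‖w‖ ^ 2 := by
      have : 0 < u (φ n) * inner ℝ w v := mul_pos hε hX
      rcases abs_cases (inner ℝ c w) with h | h <;> nlinarith [sq_nonneg ‖w‖]
    have hw0 : 0 ≤ ‖w‖ := norm_nonneg w
    generalize inner ℝ w v = X at *
    generalize inner ℝ a w = T at *
    generalize inner ℝ a c = Z at *
    generalize inner ℝ a v = α at *
    generalize u (φ n) = ε at *
    generalize inner ℝ c w = Y0 at *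
    generalize |Y0| = Y at *
    generalize ‖w‖ = W at *
    have e1 : Y ^ 2 ≤ R * W * Y := by nlinarith
    have e2 : R * W * (2 * Y) ≤ R * W * (2 * ε * X + W ^ 2) :=
      mul_le_mul_of_nonneg_left hYε (by positivity)
    have e3 : R * W * W ^ 2 ≤ R * R * W ^ 2 :=
      mul_le_mul_of_nonneg_right (mul_le_mul_of_nonneg_left hn.le hR.le) (sq_nonneg W)
    have e4 : R ^ 2 * W ^ 2 ≤ X * (2 * X + 2 * R * W * ε) := by nlinarith
    have e5 : 2 * α * X ≤ R ^ 2 * W ^ 2 + 2 * M * Y := by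
      have : 2 * T - 2 * Y0 ≤ W ^ 2 := by linarith
      have := mul_le_mul_of_nonneg_left this (sq_nonneg R)
      linarith
    have e6 : 2 * α * X ≤ (R ^ 2 + M) * W ^ 2 + 2 * M * ε * X := by
      have := mul_le_mul_of_nonneg_left hYε hM0
      linarith
    have e7 : 2 * α * X * R ^ 2 ≤ (R ^ 2 + M) * (R ^ 2 * W ^ 2) + 2 * M * ε * X * R ^ 2 := by
      have := mul_le_mul_of_nonneg_right e6 (sq_nonneg R)
      linarith
    have e8 := mul_le_mul_of_nonneg_left e4 (by positivity : 0 ≤ R ^ 2 + M)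
    refine le_of_mul_le_mul_right ?_ hX
    linarith
  have hlimit : Tendsto (fun n => (R ^ 2 + M) *
      (2 * inner ℝ (k (φ n) - c) v + 2 * R * ‖k (φ n) - c‖ * u (φ n))
        + 2 * M * R ^ 2 * u (φ n)) atTop (𝓝 0) := by
    have := ((((hw.inner (tendsto_const_nhds (x := v))).const_mul 2).add
      ((hw.norm.const_mul (2 * R)).mul huφ)).const_mul (R ^ 2 + M)).add
        (huφ.const_mul (2 * M * R ^ 2))
    simpa using this
  have := ge_of_tendsto hlimit hmain
  have : 0 < 2 * inner ℝ a v * R ^ 2 := by positivity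
  linarith

/-! ### The planar case. -/

theorem eq_or_eq_neg_of_det_eq_zero {R : ℝ} (hR : 0 < R) {c d : EuclideanSpace ℝ (Fin 2)}
    (hc : ‖c‖ = R) (hd : ‖d‖ = R) (h : c 0 * d 1 - c 1 * d 0 = 0) : c = d ∨ c = -d := by
  rw [plane_norm_eq_iff hR.le] at hc hd
  have h1 : ((c 0 - d 0) ^ 2 + (c 1 - d 1) ^ 2) * ((c 0 + d 0) ^ 2 + (c 1 + d 1) ^ 2) = 0 := by
    linear_combination 4 * (c 0 * d 1 - c 1 * d 0) * h
      + (c 0 ^ 2 + c 1 ^ 2 - d 0 ^ 2 - d 1 ^ 2) * hc - (c 0 ^ 2 + c 1 ^ 2 - d 0 ^ 2 - d 1 ^ 2) * hd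
  rcases mul_eq_zero.1 h1 with h2 | h2
  · left
    rw [← sub_eq_zero]
    by_contra hne
    rw [← ne_eq, plane_ne_zero_iff] at hne
    exact hne.ne' (by simpa using h2)
  · right
    rw [← sub_eq_zero, sub_neg_eq_add]
    by_contra hne
    rw [← ne_eq, plane_ne_zero_iff] at hne
    exact hne.ne' (by simpa using h2)

/-- In the plane, if `A` is closed, misses `0`, and every point outside `A` is within `R` of the
centre of an open disc of radius `R` missing `A`, then `0` lies in such an open disc. -/
theorem exists_open_disc {R : ℝ} (hR : 0 < R) {A : Set (EuclideanSpace ℝ (Fin 2))}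
    (hA : IsClosed A) (h0 : (0 : EuclideanSpace ℝ (Fin 2)) ∉ A)
    (hcov : ∀ x ∉ A, ∃ c, ‖x - c‖ ≤ R ∧ ∀ a ∈ A, R ≤ ‖a - c‖) :
    ∃ q : EuclideanSpace ℝ (Fin 2), ‖q‖ < R ∧ ∀ a ∈ A, R ≤ ‖a - q‖ := by
  by_contra! hbad
  have hA0 : ∀ a ∈ A, a ≠ 0 := fun a ha h => h0 (h ▸ ha)
  set K : Set (EuclideanSpace ℝ (Fin 2)) := {c | ‖c‖ = R ∧ ∀ a ∈ A, R ≤ ‖a - c‖} with hK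
  have hside : ∀ v ≠ 0, ∃ c ∈ K, 0 < inner ℝ c v := by
    intro v hv
    have hv' : 0 < ‖v‖ := norm_pos_iff.2 hv
    obtain ⟨c, h1, h2, h3⟩ := exists_center_inner_pos hR hA h0 hcov hbad
      (v := (R / ‖v‖) • v) (by
        rw [norm_smul, Real.norm_of_nonneg (by positivity)]
        field_simp)
    refine ⟨c, ⟨h1, h2⟩, ?_⟩
    rw [inner_smul_right] at h3
    exact pos_of_mul_pos_right h3 (by positivity)
  have htriple : ∀ c₁ ∈ K, ∀ c₂ ∈ K, ∀ c₃ ∈ K, ∀ l₁ l₂ l₃ : ℝ, 0 < l₁ → 0 < l₂ → 0 < l₃ →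
      l₁ • c₁ + l₂ • c₂ + l₃ • c₃ = 0 → c₁ 0 * c₂ 1 - c₁ 1 * c₂ 0 = 0 := by
    intro c₁ h₁ c₂ h₂ c₃ h₃ l₁ l₂ l₃ hl₁ hl₂ hl₃ hs
    by_contra hdet
    obtain ⟨q, hq, H⟩ := johnson_disc hR h₁.1 h₂.1 h₃.1 hl₁ hl₂ hl₃ hs hdet
    obtain ⟨a, ha, haq⟩ := hbad q hq
    exact absurd (H a (hA0 a ha) (h₁.2 a ha) (h₂.2 a ha) (h₃.2 a ha)) (not_le.2 haq)
  have hpair : ∀ c ∈ K, -c ∉ K := by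
    intro c hc hc'
    have hc0 := hc.1
    rw [plane_norm_eq_iff hR.le] at hc0
    have hR2 : 0 < R ^ 2 := by positivity
    have hv : (!₂[-c 1, c 0] : EuclideanSpace ℝ (Fin 2)) ≠ 0 := by
      rw [plane_ne_zero_iff]; simp; linarith
    obtain ⟨d, hd, hdv⟩ := hside _ hv
    obtain ⟨e, he, hev⟩ := hside _ (neg_ne_zero.2 hv)
    rw [plane_inner] at hdv
    rw [inner_neg_right, plane_inner] at hev
    simp only [Matrix.cons_val_zero, Matrix.cons_val_one] at hdv hev
    -- The centres `d`, `e` lie on opposite sides of the line through `±c`. The sign of their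
    -- determinant decides which of `c`, `-c` positively spans the plane with them, with minors as
    -- coefficients; if it vanishes, `d = -e` and the rhombus applies.
    rcases lt_trichotomy (d 0 * e 1 - d 1 * e 0) 0 with h | h | h
    · have := htriple (-c) hc' d hd e he (d 1 * e 0 - d 0 * e 1) (c 0 * -e 1 - c 1 * -e 0)
        (c 0 * d 1 - c 1 * d 0) (by linarith) (by linarith) (by linarith) (by
          ext i; fin_cases i <;> simp <;> ring)
      simp only [PiLp.neg_apply] at this
      linarith
    · rcases eq_or_eq_neg_of_det_eq_zero hR hd.1 he.1 h with rfl | rfl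
      · linarith
      · have hce : c ≠ e := by rintro rfl; linarith
        have hce' : c ≠ -e := by
          rintro rfl
          simp only [PiLp.neg_apply] at hev
          linarith
        obtain ⟨q, hq, H⟩ := rhombus_disc hR hc.1 he.1 hce hce'
        obtain ⟨a, ha, haq⟩ := hbad q hq
        exact absurd (H a (hA0 a ha) (hc.2 a ha) (by simpa using hc'.2 a ha) (he.2 a ha)
          (by simpa using hd.2 a ha)) (not_le.2 haq)
    · have := htriple c hc d hd e he (d 0 * e 1 - d 1 * e 0) (c 0 * -e 1 - c 1 * -e 0)
        (c 0 * d 1 - c 1 * d 0) (by linarith) (by linarith) (by linarith) (by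
          ext i; fin_cases i <;> simp <;> ring)
      linarith
  have hconv : (0 : EuclideanSpace ℝ (Fin 2)) ∈ convexHull ℝ K := by
    -- A finite subset of `K` still meets every open half-plane, and its convex hull is closed, so
    -- strict separation is available.
    obtain ⟨t, ht⟩ := (isCompact_sphere (0 : EuclideanSpace ℝ (Fin 2)) 1).elim_finite_subcover
      (fun c : K => {v | 0 < inner ℝ c.1 v})
      (fun c => isOpen_lt continuous_const (by fun_prop)) (fun v hv => by
        obtain ⟨c, hc, h⟩ := hside v (ne_zero_of_mem_unit_sphere ⟨v, hv⟩)
        exact Set.mem_iUnion.2 ⟨⟨c, hc⟩, h⟩)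
    have htK : Subtype.val '' (t : Set K) ⊆ K := by
      rintro _ ⟨c, -, rfl⟩
      exact c.2
    refine convexHull_mono htK ?_
    by_contra hnot
    have htside : ∀ v ≠ 0, ∃ c ∈ Subtype.val '' (t : Set K), 0 < inner ℝ c v := by
      intro v hv
      have hv' : 0 < ‖v‖ := norm_pos_iff.2 hv
      have hmem : ‖v‖⁻¹ • v ∈ Metric.sphere (0 : EuclideanSpace ℝ (Fin 2)) 1 := by
        rw [mem_sphere_zero_iff_norm, norm_smul, norm_inv, norm_norm, inv_mul_cancel₀ hv'.ne']
      obtain ⟨c, hct, hc⟩ := Set.mem_iUnion₂.1 (ht hmem)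
      refine ⟨c, ⟨c, hct, rfl⟩, ?_⟩
      have hc' : 0 < inner ℝ c.1 (‖v‖⁻¹ • v) := hc
      rw [inner_smul_right] at hc'
      exact pos_of_mul_pos_right hc' (by positivity)
    obtain ⟨f, u, hu0, hu⟩ := geometric_hahn_banach_point_closed (convex_convexHull ℝ _)
      ((t.finite_toSet.image _).isCompact_convexHull ℝ).isClosed hnot
    rw [map_zero] at hu0
    set g := (InnerProductSpace.toDual ℝ (EuclideanSpace ℝ (Fin 2))).symm f with hg
    have hfg : ∀ x, f x = inner ℝ x g := by
      intro x
      rw [real_inner_comm, hg, InnerProductSpace.toDual_symm_apply]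
    have hpos : ∀ c ∈ Subtype.val '' (t : Set K), 0 < inner ℝ c g := fun c hc => by
      rw [← hfg]; exact hu0.trans (hu c (subset_convexHull ℝ _ hc))
    by_cases hg0 : g = 0
    · obtain ⟨c, hc, -⟩ := htside (EuclideanSpace.single 0 1) (by simp)
      have := hpos c hc
      rw [hg0, inner_zero_right] at this
      exact this.false
    · obtain ⟨c, hc, h⟩ := htside (-g) (neg_ne_zero.2 hg0)
      rw [inner_neg_right] at h
      linarith [hpos c hc]
  obtain ⟨ι, _, z, w, hz, hind, hw, hw1, hsum⟩ := eq_pos_convex_span_of_mem_convexHull hconv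
  have hzK : ∀ i, z i ∈ K := fun i => hz ⟨i, rfl⟩
  have hne0 : ∀ c ∈ K, c ≠ 0 := fun c hc h => by
    have := hc.1
    rw [h, norm_zero] at this
    exact hR.ne this
  have hcard : Fintype.card ι ≤ 3 := by
    have := hind.card_le_finrank_succ
    have h2 := Submodule.finrank_le (vectorSpan ℝ (Set.range z))
    rw [finrank_euclideanSpace_fin] at h2
    omega
  have e := (Fintype.equivFin ι).symm
  have hinj := hind.injective.comp e.injective
  rw [← e.sum_comp] at hw1 hsum
  generalize Fintype.card ι = n at *
  interval_cases n
  · simp at hw1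
  · simp only [Fin.sum_univ_one] at hw1 hsum
    rw [hw1, one_smul] at hsum
    exact hne0 _ (hzK _) hsum
  · rw [Fin.sum_univ_two] at hsum
    have h1 : w (e 1) • z (e 1) = -(w (e 0) • z (e 0)) := (neg_eq_of_add_eq_zero_right hsum).symm
    have h2 := congrArg norm h1
    rw [norm_neg, norm_smul, norm_smul, (hzK _).1, (hzK _).1, Real.norm_of_nonneg (hw _).le,
      Real.norm_of_nonneg (hw _).le] at h2
    have h3 := mul_right_cancel₀ hR.ne' h2
    rw [h3, ← smul_neg] at h1
    have h4 := smul_right_injective _ (hw (e 0)).ne' h1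
    exact hpair _ (hzK (e 0)) (h4 ▸ hzK (e 1))
  · rw [Fin.sum_univ_three] at hsum
    have hdet := htriple _ (hzK (e 0)) _ (hzK (e 1)) _ (hzK (e 2)) _ _ _ (hw _) (hw _) (hw _) hsum
    rcases eq_or_eq_neg_of_det_eq_zero hR (hzK _).1 (hzK _).1 hdet with h | h
    · exact absurd (hinj h) (by decide)
    · exact hpair _ (hzK (e 1)) (h ▸ hzK (e 0))

theorem mem_RBodies_of_mem_ClassK2 {R : ℝ} (hR : 0 < R) {A : Set (EuclideanSpace ℝ (Fin 2))}
    (hA : A ∈ ClassK2 2 R) (hreg : A = closure (interior A)) : A ∈ RBodies 2 R := by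
  obtain ⟨hbody, hcov⟩ := hA
  refine ⟨hbody, fun y hy => ?_⟩
  -- Regularity enters only here: an open disc meeting `A` would meet `interior A`.
  have hball : ∀ c, Metric.closedBall c R ∩ interior A = ∅ → ∀ a ∈ A, R ≤ ‖a - c‖ := by
    intro c hc a ha
    by_contra hlt
    rw [hreg] at ha
    have hac : a ∈ Metric.ball c R := by rw [mem_ball_iff_norm]; exact not_le.1 hlt
    obtain ⟨x, hx, hxA⟩ := mem_closure_iff.1 ha _ Metric.isOpen_ball hac
    exact (Set.mem_empty_iff_false x).1 (hc ▸ ⟨Metric.ball_subset_closedBall hx, hxA⟩)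
  obtain ⟨q, hq, H⟩ := exists_open_disc hR (A := (fun x => x + y) ⁻¹' A)
    (hbody.2.preimage (by fun_prop)) (by simpa using hy) (by
      intro x hx
      obtain ⟨c, hxc, hc⟩ := hcov (x + y) hx
      refine ⟨c - y, ?_, fun a ha => ?_⟩
      · rw [mem_closedBall_iff_norm] at hxc
        rwa [sub_sub_eq_add_sub]
      · rw [sub_sub_eq_add_sub]
        exact hball c hc _ ha)
  refine ⟨q + y, ?_, fun x hx hxA => ?_⟩
  · rw [mem_ball_iff_norm]
    simpa using hq
  · have := H (x - y) (by simpa using hxA)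
    rw [mem_ball_iff_norm] at hx
    rw [sub_sub, add_comm y q] at this
    linarith

/-! ### The regular simplex and the example in dimension above two. -/

/-- The vertices of a regular simplex inscribed in the sphere of radius `R` about `0`: their
inner products, and the fact that the simplex contains the ball of radius `R / d`. -/
theorem exists_regular_simplex {d : ℕ} (hd : 0 < d) {R : ℝ} (hR : 0 < R) :
    ∃ c : Fin (d + 1) → EuclideanSpace ℝ (Fin d), (∀ i, ‖c i‖ = R) ∧
      (∀ i j, i ≠ j → inner ℝ (c i) (c j) = -(R ^ 2 / d)) ∧
      ∀ q, ∃ i, inner ℝ (c i) q ≤ -(R / d * ‖q‖) := by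
  have hd' : (0 : ℝ) < d := Nat.cast_pos.2 hd
  obtain ⟨v, hv⟩ : ∃ v : EuclideanSpace ℝ (Fin (d + 1)), v = WithLp.toLp 2 (fun _ => 1) :=
    ⟨_, rfl⟩
  have hv1 : ∀ i, v i = 1 := by simp [hv]
  have hvi : ∀ x : EuclideanSpace ℝ (Fin (d + 1)), inner ℝ v x = ∑ i, x i := by
    intro x; simp [PiLp.inner_apply, hv1]
  have hv0 : v ≠ 0 := by
    intro h
    have := hv1 0
    simp [h] at this
  have : Fact (Module.finrank ℝ (EuclideanSpace ℝ (Fin (d + 1))) = d + 1) := ⟨by simp⟩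
  -- Project the standard basis of dimension `d + 1` onto the hyperplane orthogonal to the all-ones
  -- vector; `s` below rescales to norm `R`.
  obtain ⟨u, hu⟩ : ∃ u : Fin (d + 1) → EuclideanSpace ℝ (Fin (d + 1)),
      ∀ i, u i = EuclideanSpace.single i 1 - (1 / (d + 1 : ℝ)) • v := ⟨_, fun _ => rfl⟩
  have hvv : inner ℝ v v = (d + 1 : ℝ) := by rw [hvi]; simp [hv1]
  have hve : ∀ i, inner ℝ v (EuclideanSpace.single i (1 : ℝ)) = (1 : ℝ) := by
    intro i; rw [EuclideanSpace.inner_single_right]; simp [hv1]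
  have huS : ∀ i, u i ∈ (Submodule.span ℝ {v})ᗮ := by
    intro i
    rw [Submodule.mem_orthogonal_singleton_iff_inner_right, hu, inner_sub_right, inner_smul_right,
      hvv, hve]
    field_simp
    simp
  have huu : ∀ i j, inner ℝ (u i) (u j) = (if i = j then 1 else 0) - 1 / (d + 1 : ℝ) := by
    intro i j
    have h1 := (Submodule.mem_orthogonal_singleton_iff_inner_left).1 (huS i)
    rw [hu j, inner_sub_right, inner_smul_right, h1, hu i, inner_sub_left, inner_smul_left, hve]
    simp [EuclideanSpace.inner_single_left]
  let b := OrthonormalBasis.fromOrthogonalSpanSingleton (𝕜 := ℝ) d hv0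
  set s := √(R ^ 2 * (d + 1) / d) with hs
  have hs2 : s ^ 2 = R ^ 2 * (d + 1) / d := Real.sq_sqrt (by positivity)
  obtain ⟨c, hc⟩ : ∃ c : Fin (d + 1) → EuclideanSpace ℝ (Fin d),
      ∀ i, c i = s • b.repr ⟨u i, huS i⟩ := ⟨_, fun _ => rfl⟩
  have hcc : ∀ i j, inner ℝ (c i) (c j) = s ^ 2 * ((if i = j then 1 else 0) - 1 / (d + 1 : ℝ)) := by
    intro i j
    rw [hc, hc, inner_smul_left, inner_smul_right, LinearIsometryEquiv.inner_map_map,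
      Submodule.coe_inner, huu]
    simp; ring
  refine ⟨c, fun i => ?_, fun i j hij => ?_, fun q => ?_⟩
  · rw [← sq_eq_sq₀ (norm_nonneg _) hR.le, ← real_inner_self_eq_norm_sq, hcc, hs2]
    field_simp
    simp
  · rw [hcc, hs2, if_neg hij]
    field_simp
    simp
  · obtain ⟨x, hx⟩ : ∃ x, x = b.repr.symm q := ⟨_, rfl⟩
    have hxq : b.repr x = q := by rw [hx]; simp
    have hxv : ∑ i, (x : EuclideanSpace ℝ (Fin (d + 1))) i = 0 := by
      rw [← hvi]
      exact (Submodule.mem_orthogonal_singleton_iff_inner_right).1 x.2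
    have hxn : ∑ i, (x : EuclideanSpace ℝ (Fin (d + 1))) i ^ 2 = ‖q‖ ^ 2 := by
      rw [← hxq, LinearIsometryEquiv.norm_map, Submodule.coe_norm, EuclideanSpace.real_norm_sq_eq]
    have hcq : ∀ i, inner ℝ (c i) q = s * (x : EuclideanSpace ℝ (Fin (d + 1))) i := by
      intro i
      rw [← hxq, hc, inner_smul_left, LinearIsometryEquiv.inner_map_map, Submodule.coe_inner]
      change _ * inner ℝ (u i) x.1 = _
      rw [hu, inner_sub_left, inner_smul_left, hvi, hxv]
      simp [EuclideanSpace.inner_single_left]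
    by_contra! hlt
    set m := R / d * ‖q‖ with hm
    have hsum : ∑ i, inner ℝ (c i) q = 0 := by
      simp only [hcq, ← Finset.mul_sum, hxv, mul_zero]
    have hsq : ∑ i, inner ℝ (c i) q ^ 2 = d * (d + 1) * m ^ 2 := by
      simp only [hcq, mul_pow, ← Finset.mul_sum, hxn, hs2, hm]
      field_simp
    have hle : ∀ i, inner ℝ (c i) q < d * m := by
      intro i
      have hsum := hsum
      rw [← Finset.add_sum_erase _ _ (Finset.mem_univ i)] at hsum
      have : ∑ j ∈ Finset.univ.erase i, -m < ∑ j ∈ Finset.univ.erase i, inner ℝ (c j) q := by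
        refine Finset.sum_lt_sum_of_nonempty ?_ fun j _ => hlt j
        rw [← Finset.card_pos, Finset.card_erase_of_mem (Finset.mem_univ i)]
        simpa using hd
      rw [Finset.sum_const, Finset.card_erase_of_mem (Finset.mem_univ i),
        Finset.card_univ, Fintype.card_fin, Nat.add_sub_cancel, nsmul_eq_mul] at this
      linarith
    -- Each inner product lies strictly between `-m` and `d * m`, yet the first two moments make
    -- this sum vanish.
    have hpos : 0 < ∑ i, (inner ℝ (c i) q + m) * (d * m - inner ℝ (c i) q) :=
      Finset.sum_pos (fun i _ => mul_pos (by linarith [hlt i]) (by linarith [hle i]))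
        Finset.univ_nonempty
    have hexp : ∑ i, (inner ℝ (c i) q + m) * (d * m - inner ℝ (c i) q)
        = (d * m - m) * ∑ i, inner ℝ (c i) q - ∑ i, inner ℝ (c i) q ^ 2
          + ∑ i : Fin (d + 1), d * m ^ 2 := by
      rw [Finset.mul_sum, ← Finset.sum_sub_distrib, ← Finset.sum_add_distrib]
      exact Finset.sum_congr rfl fun i _ => by ring
    rw [hexp, hsum, hsq] at hpos
    simp at hpos
    linarith

theorem closedBall_inter_interior_eq_empty {d : ℕ} {R : ℝ} (hR : 0 < R)
    {A : Set (EuclideanSpace ℝ (Fin d))} {c : EuclideanSpace ℝ (Fin d)}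
    (h : Metric.ball c R ⊆ Aᶜ) : Metric.closedBall c R ∩ interior A = ∅ := by
  rw [← closure_ball c hR.ne', ← Set.disjoint_iff_inter_eq_empty]
  refine Disjoint.closure_left ?_ isOpen_interior
  exact (Set.disjoint_compl_left_iff_subset.2 interior_subset).mono_left h

theorem exists_regular_mem_ClassK2_not_mem_RBodies {d : ℕ} (hd : 2 < d) {R : ℝ} (hR : 0 < R) :
    ∃ A ∈ ClassK2 d R, A = closure (interior A) ∧ A ∉ RBodies d R := by
  obtain ⟨c, hc, hcc, hcq⟩ := exists_regular_simplex (by omega : 0 < d) hR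
  have hd' : (3 : ℝ) ≤ d := by exact_mod_cast hd
  have hd0 : (0 : ℝ) < d := by linarith
  -- Among points outside all the open balls, the bound `2 * R / d` excludes only `0`.
  set A : Set (EuclideanSpace ℝ (Fin d)) := {x | 2 * R / d ≤ ‖x‖ ∧ ∀ i, R ≤ ‖x - c i‖} with hA
  have hsub : ∀ (x : EuclideanSpace ℝ (Fin d)) i,
      ‖x - c i‖ ^ 2 = ‖x‖ ^ 2 - 2 * inner ℝ (c i) x + R ^ 2 := by
    intro x i
    rw [norm_sub_sq_real, hc, real_inner_comm]
  -- These are the points other than `0` common to the `d` spheres about the `c j`, `j ≠ i`.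
  have hpA : ∀ i, -(2 / d : ℝ) • c i ∈ A := by
    intro i
    have hn : ‖-(2 / d : ℝ) • c i‖ = 2 * R / d := by
      rw [norm_smul, hc, norm_neg, Real.norm_of_nonneg (by positivity)]
      ring
    refine ⟨hn.ge, fun j => ?_⟩
    rw [← sq_le_sq₀ hR.le (norm_nonneg _), hsub, hn, inner_smul_right]
    by_cases hij : j = i
    · rw [hij, real_inner_self_eq_norm_sq, hc]
      have : 0 ≤ (2 * R / d) ^ 2 - 2 * (-(2 / d) * R ^ 2) := by
        have : (2 * R / d) ^ 2 - 2 * (-(2 / d) * R ^ 2) = (2 * R / d) ^ 2 + 4 / d * R ^ 2 := by ring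
        rw [this]; positivity
      linarith
    · rw [hcc j i hij]
      apply le_of_eq
      field_simp
      ring
  have hclosed : IsClosed A := by
    rw [hA, Set.ofPred_and, Set.ofPred_forall]
    refine (isClosed_le continuous_const continuous_norm).inter ?_
    exact isClosed_iInter fun i => isClosed_le continuous_const (by fun_prop)
  have h0A : (0 : EuclideanSpace ℝ (Fin d)) ∉ A := by
    intro h
    have h1 : 2 * R / d ≤ ‖(0 : EuclideanSpace ℝ (Fin d))‖ := h.1
    rw [norm_zero] at h1
    have : 0 < 2 * R / d := by positivity
    linarith
  refine ⟨A, ⟨⟨⟨_, hpA 0⟩, hclosed⟩, fun x hx => ?_⟩, ?_, fun hmem => ?_⟩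
  · have hball : ∀ i, Metric.closedBall (c i) R ∩ interior A = ∅ := fun i =>
      closedBall_inter_interior_eq_empty hR fun z hz hzA =>
        absurd (hzA.2 i) (not_le.2 (mem_ball_iff_norm.1 hz))
    suffices h : ∃ i, ‖x - c i‖ ≤ R by
      obtain ⟨i, hi⟩ := h
      exact ⟨c i, mem_closedBall_iff_norm.2 hi, hball i⟩
    by_contra! hlt
    refine hx ⟨?_, fun i => (hlt i).le⟩
    obtain ⟨i, hi⟩ := hcq (-x)
    rw [inner_neg_right, norm_neg] at hi
    have h1 := pow_le_pow_left₀ hR.le (hlt i).le 2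
    rw [hsub] at h1
    have hx0 : 0 < ‖x‖ := by
      rw [norm_pos_iff]
      rintro rfl
      have := hlt 0
      rw [zero_sub, norm_neg, hc] at this
      exact this.false
    refine le_of_mul_le_mul_right ?_ hx0
    have : 2 * R / d * ‖x‖ = 2 * (R / d * ‖x‖) := by ring
    nlinarith
  · refine Set.Subset.antisymm (fun x hx => ?_) (hclosed.closure_subset_iff.2 interior_subset)
    have hx0 : 0 < ‖x‖ := lt_of_lt_of_le (by positivity) hx.1
    -- Dilating a point of `A` by `t > 1` makes all its defining inequalities strict.
    have htend : Tendsto (fun t : ℝ => t • x) (𝓝[>] 1) (𝓝 x) := by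
      have : Tendsto (fun t : ℝ => t • x) (𝓝 1) (𝓝 ((1 : ℝ) • x)) :=
        (continuous_id.smul continuous_const).tendsto 1
      rw [one_smul] at this
      exact this.mono_left nhdsWithin_le_nhds
    refine mem_closure_of_tendsto htend ?_
    filter_upwards [self_mem_nhdsWithin] with t ht
    have ht1 : 1 < t := ht
    set U : Set (EuclideanSpace ℝ (Fin d)) := {x | 2 * R / d < ‖x‖ ∧ ∀ i, R < ‖x - c i‖} with hU
    have hUA : U ⊆ A := fun z hz => ⟨hz.1.le, fun i => (hz.2 i).le⟩
    have hopen : IsOpen U := by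
      rw [hU, Set.ofPred_and, Set.ofPred_forall]
      refine (isOpen_lt continuous_const continuous_norm).inter ?_
      exact isOpen_iInter_of_finite fun i => isOpen_lt continuous_const (by fun_prop)
    refine interior_maximal hUA hopen ⟨?_, fun i => ?_⟩
    · rw [norm_smul, Real.norm_of_nonneg (by linarith)]
      nlinarith [hx.1]
    · have h1 := pow_le_pow_left₀ hR.le (hx.2 i) 2
      rw [hsub] at h1
      rw [← sq_lt_sq₀ hR.le (norm_nonneg _), hsub, norm_smul, inner_smul_right,
        Real.norm_of_nonneg (by linarith)]
      have h2 : 0 < t * (t - 1) * ‖x‖ ^ 2 :=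
        mul_pos (mul_pos (by linarith) (by linarith)) (by positivity)
      have h3 : 0 ≤ t * (‖x‖ ^ 2 - 2 * inner ℝ (c i) x) := mul_nonneg (by linarith) (by linarith)
      linarith
  · obtain ⟨q, hq0, hq⟩ := hmem.2 0 h0A
    rw [mem_ball_iff_norm, zero_sub, norm_neg] at hq0
    obtain ⟨i, hi⟩ := hcq q
    have h1 : R ≤ ‖-(2 / d : ℝ) • c i - q‖ := by
      by_contra hlt
      exact hq (mem_ball_iff_norm.2 (not_le.1 hlt)) (hpA i)
    have h2 := pow_le_pow_left₀ hR.le h1 2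
    rw [norm_sub_sq_real, inner_smul_left, norm_smul, hc, norm_neg,
      Real.norm_of_nonneg (by positivity)] at h2
    simp only [conj_trivial] at h2
    have h3 : 4 / d * inner ℝ (c i) q ≤ 4 / d * (-(R / d * ‖q‖)) :=
      mul_le_mul_of_nonneg_left hi (by positivity)
    obtain ⟨e, he⟩ : ∃ e : ℝ, e = 2 / d := ⟨_, rfl⟩
    -- Here `d > 2` is essential: for `d = 2` one has `e = 1`, and the ball centred at `q = 0` gives
    -- no contradiction.
    have he1 : e < 1 := by rw [he, div_lt_one hd0]; linarith
    have he0 : 0 < e := by rw [he]; positivity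
    have h4 : R ^ 2 ≤ e ^ 2 * R ^ 2 - e ^ 2 * R * ‖q‖ + ‖q‖ ^ 2 := by
      have : (4 / d : ℝ) * (-(R / d * ‖q‖)) = -(e ^ 2 * R * ‖q‖) := by rw [he]; ring
      rw [this] at h3
      have h5 : (4 / d : ℝ) = 2 * e := by rw [he]; ring
      rw [h5] at h3
      rw [← he] at h2
      linarith
    have h6 : (R - ‖q‖) * (R * (1 - e ^ 2) + ‖q‖) ≤ 0 := by linarith
    have h7 : 0 < 1 - e ^ 2 := by nlinarith
    have h8 : 0 < (R - ‖q‖) * (R * (1 - e ^ 2) + ‖q‖) :=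
      mul_pos (by linarith) (by have := norm_nonneg q; positivity)
    linarith

/-! ### Inclusion and strictness. -/

theorem RBodies_subset_ClassK2 (d : ℕ) {R : ℝ} (hR : 0 < R) : RBodies d R ⊆ ClassK2 d R :=
  fun _ hA => ⟨hA.1, fun x hx =>
    have ⟨c, hxc, hc⟩ := hA.2 x hx
    ⟨c, Metric.ball_subset_closedBall hxc, closedBall_inter_interior_eq_empty hR hc⟩⟩

theorem sphere_mem_ClassK2 {d : ℕ} (hd : 0 < d) {R : ℝ} (hR : 0 < R) :
    Metric.sphere (0 : EuclideanSpace ℝ (Fin d)) (R / 2) ∈ ClassK2 d R := by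
  have : Nonempty (Fin d) := ⟨⟨0, hd⟩⟩
  refine ⟨⟨NormedSpace.sphere_nonempty.2 (by positivity), Metric.isClosed_sphere⟩, fun x _ =>
    ⟨x, Metric.mem_closedBall_self hR.le, ?_⟩⟩
  rw [interior_sphere _ (by positivity), Set.inter_empty]

theorem sphere_not_mem_RBodies {d : ℕ} (hd : 0 < d) {R : ℝ} (hR : 0 < R) :
    Metric.sphere (0 : EuclideanSpace ℝ (Fin d)) (R / 2) ∉ RBodies d R := by
  have : Nonempty (Fin d) := ⟨⟨0, hd⟩⟩
  intro h
  obtain ⟨c, h0, hc⟩ := h.2 0 (fun h0 => by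
    rw [mem_sphere_zero_iff_norm, norm_zero] at h0
    linarith)
  rw [mem_ball_iff_norm, zero_sub, norm_neg] at h0
  obtain ⟨u, hu, hcu⟩ : ∃ u : EuclideanSpace ℝ (Fin d), ‖u‖ = 1 ∧ c = ‖c‖ • u := by
    by_cases h : c = 0
    · obtain ⟨u, hu⟩ := exists_norm_eq (EuclideanSpace ℝ (Fin d)) zero_le_one
      exact ⟨u, hu, by simp [h]⟩
    · have : ‖c‖ ≠ 0 := norm_ne_zero_iff.2 h
      exact ⟨‖c‖⁻¹ • c, by rw [norm_smul, norm_inv, norm_norm, inv_mul_cancel₀ this],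
        by rw [smul_smul, mul_inv_cancel₀ this, one_smul]⟩
  -- The point of the sphere in the direction of `c` is at distance `|‖c‖ - R / 2| < R` from `c`.
  refine hc (a := (R / 2) • u) ?_ ?_
  · rw [mem_ball_iff_norm, hcu, ← sub_smul, norm_smul, hu, mul_one, Real.norm_eq_abs, abs_lt]
    constructor <;> linarith [norm_nonneg c]
  · rw [mem_sphere_zero_iff_norm, norm_smul, hu, mul_one, Real.norm_of_nonneg (by positivity)]

theorem mainTheorem10 (d : ℕ) (hd : 2 ≤ d) (R : ℝ) (hR : 0 < R) :
    RBodies d R ⊂ ClassK2 d R ∧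
    (d = 2 → ∀ A ∈ ClassK2 d R, A = closure (interior A) → A ∈ RBodies d R) ∧
    (2 < d → ∃ A ∈ ClassK2 d R, A = closure (interior A) ∧ A ∉ RBodies d R) := by
  refine ⟨⟨RBodies_subset_ClassK2 d hR, fun h => ?_⟩, ?_, fun h =>
    exists_regular_mem_ClassK2_not_mem_RBodies h hR⟩
  · have hd0 : 0 < d := by omega
    exact sphere_not_mem_RBodies hd0 hR (h (sphere_mem_ClassK2 hd0 hR))
  · rintro rfl A hA hreg
    exact mem_RBodies_of_mem_ClassK2 hR hA hreg
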